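/- Let $t\ge 3$ be an integer and write $[t]=\{1,\dots,t\}$. There is a sequence of real numbers $(\delta_k)_{k\ge 0}$ (which may depend on $t$) with $\delta_k\to 0$ as $k\to\infty$ such that for every integer $k\ge 0$ there is a set $X\subseteq [t]^k$ of exactly $$|X|=(t-1)^{\left(\frac{t-1}{t}-\delta_k\right)k}$$ strings of length $k$ over the alphabet $[t]$ with the following property: for any two distinct strings $x,x'\in X$ and any letter $a\in[t]$, there is a position $i\in\{1,\dots,k\}$ such that $x(i)\ne x'(i)$, $x(i)\ne a$ and $x'(i)\ne a$. -/

import Mathlib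

/-! If two distinct strings have the letter `a` in the same positions, any position where they
differ avoids `a` in both. So it suffices to control, for every `a` at once, where `a` occurs. Place
balanced blocks of length `t * m` on the grid `[n]^t`. For each point `q`, fix the sum over `a` of
the encoded position set of `a` in the block at `q - e_a`. By pigeonhole
(`exists_separated_of_colouring`) this divides the count by at most `K ^ ((n + 1) ^ t)`, where `K =
(t * m).choose m`. Thus one constraint per block serves all `t` letters, up to boundary. There are
`t ^ (t * m)` balanced blocks up to a polynomial factor, and `K * (t - 1) ^ ((t - 1) * m) ≤ t ^ (t *
m)`. Each block thus contributes about `(t - 1) ^ ((t - 1) * m)`, which is the claimed rate.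
Concatenation and padding reach every length; passing to subsets keeps the size below the target,
and `δ` is then read off from the size. -/

/-- Any two distinct strings of `X` can be told apart, for each letter `a`, at a position where
neither of them has the letter `a`. -/
def Separated {ι : Type*} {t : ℕ} (X : Finset (ι → Fin t)) : Prop :=
  ∀ x ∈ X, ∀ x' ∈ X, x ≠ x' → ∀ a : Fin t, ∃ i : ι, x i ≠ x' i ∧ x i ≠ a ∧ x' i ≠ a

theorem Separated.mono {ι : Type*} {t : ℕ} {X Y : Finset (ι → Fin t)} (hY : Separated Y)
    (h : X ⊆ Y) : Separated X :=
  fun x hx x' hx' => hY x (h hx) x' (h hx')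

theorem separated_singleton {ι : Type*} {t : ℕ} (x : ι → Fin t) : Separated {x} := by
  intro y hy z hz h
  rw [Finset.mem_singleton] at hy hz
  exact absurd (hy.trans hz.symm) h

/-! ### Padding and concatenation -/

/-- Strings can be padded with a constant letter along an injection of positions. -/
theorem Separated.exists_extend {ι κ : Type*} {t : ℕ} [NeZero t] {X : Finset (ι → Fin t)}
    (hX : Separated X) (j : ι → κ) (hj : Function.Injective j) :
    ∃ Y : Finset (κ → Fin t), Separated Y ∧ Y.card = X.card := by
  classical
  have hinj : Function.Injective (fun x : ι → Fin t => Function.extend j x (fun _ => 0)) := by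
    intro x y h
    funext i
    have := congrFun h (j i)
    simpa only [hj.extend_apply] using this
  refine ⟨X.image (fun x => Function.extend j x (fun _ => 0)), ?_,
    Finset.card_image_of_injective _ hinj⟩
  intro y hy y' hy' hne a
  obtain ⟨x, hx, rfl⟩ := Finset.mem_image.1 hy
  obtain ⟨x', hx', rfl⟩ := Finset.mem_image.1 hy'
  obtain ⟨i, hi⟩ := hX x hx x' hx' (fun h => hne (by rw [h])) a
  exact ⟨j i, by simpa only [hj.extend_apply] using hi⟩

/-- Concatenations of strings of a separated set form a separated set. -/
theorem Separated.exists_pow {ι : Type*} {t : ℕ} {X : Finset (ι → Fin t)}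
    (hX : Separated X) (L : ℕ) :
    ∃ Y : Finset (Fin L × ι → Fin t), Separated Y ∧ Y.card = X.card ^ L := by
  classical
  have hinj : Function.Injective
      (fun w : Fin L → ι → Fin t => fun p : Fin L × ι => w p.1 p.2) := by
    intro w w' h
    funext l i
    exact congrFun h (l, i)
  refine ⟨(Fintype.piFinset fun _ : Fin L => X).image (fun w p => w p.1 p.2), ?_, ?_⟩
  · intro y hy y' hy' hne a
    obtain ⟨w, hw, rfl⟩ := Finset.mem_image.1 hy
    obtain ⟨w', hw', rfl⟩ := Finset.mem_image.1 hy'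
    obtain ⟨l, hl⟩ := Function.ne_iff.1 (fun h : w = w' => hne (by rw [h]))
    obtain ⟨i, hi⟩ := hX (w l) (Fintype.mem_piFinset.1 hw l) (w' l)
      (Fintype.mem_piFinset.1 hw' l) hl a
    exact ⟨(l, i), hi⟩
  · rw [Finset.card_image_of_injective _ hinj]
    simp

/-! ### The grid construction -/

/-- The unit step in direction `a` on the grid. -/
def gridStep {t n : ℕ} (a : Fin t) (p : Fin t → Fin n) : Fin t → Fin (n + 1) :=
  fun b => if b = a then (p b).succ else (p b).castSucc

theorem gridStep_injective {t n : ℕ} (a : Fin t) :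
    Function.Injective (gridStep (n := n) a) := by
  intro p p' h
  funext b
  have hb := congrFun h b
  unfold gridStep at hb
  split_ifs at hb
  · exact Fin.succ_injective _ hb
  · exact Fin.castSucc_injective _ hb

/-- The other blocks in the window of `p + e_a` sit at `p + e_a - e_b`, one step further in
direction `a`. -/
theorem lt_of_gridStep_eq {t n : ℕ} {a b : Fin t} (hab : b ≠ a) {p p' : Fin t → Fin n}
    (h : gridStep b p' = gridStep a p) : p a < p' a := by
  have h' := congrArg Fin.val (congrFun h a)
  simp only [gridStep, if_neg hab.symm, if_true, Fin.val_succ, Fin.val_castSucc] at h'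
  exact Fin.lt_def.2 (by omega)

/-- Arrange blocks on a `t`-dimensional grid and prescribe, for each window of `t` blocks, the sum
of the colours of the blocks, the colour of the `a`-th block being taken with respect to `a`. If
distinct blocks with equal `a`-colour are told apart for `a`, the arrangements are separated. -/
theorem exists_separated_of_colouring {β G : Type*} {t : ℕ} [AddCommGroup G] [Fintype G]
    (T : Finset (β → Fin t)) (c : Fin t → (β → Fin t) → G)
    (hc : ∀ a, ∀ x ∈ T, ∀ x' ∈ T, x ≠ x' → c a x = c a x' →
      ∃ i, x i ≠ x' i ∧ x i ≠ a ∧ x' i ≠ a) (n : ℕ) :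
    ∃ X : Finset ((Fin t → Fin n) × β → Fin t), Separated X ∧
      T.card ^ (n ^ t) ≤ X.card * Fintype.card G ^ ((n + 1) ^ t) := by
  classical
  let Φ : ((Fin t → Fin n) → β → Fin t) → (Fin t → Fin (n + 1)) → G := fun w q =>
    ∑ z : Fin t × (Fin t → Fin n), if gridStep z.1 z.2 = q then c z.1 (w z.2) else 0
  let Ω : Finset ((Fin t → Fin n) → β → Fin t) := Fintype.piFinset fun _ => T
  have hcard : Ω.card = T.card ^ (n ^ t) := by simp [Ω]
  obtain ⟨s, hs⟩ : ∃ s, Ω.card ≤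
      (Ω.filter fun w => Φ w = s).card * Fintype.card G ^ ((n + 1) ^ t) := by
    by_contra! hlt
    have h1 : Ω.card = ∑ s : (Fin t → Fin (n + 1)) → G, (Ω.filter fun w => Φ w = s).card :=
      Finset.card_eq_sum_card_fiberwise (fun _ _ => Finset.mem_coe.2 (Finset.mem_univ _))
    have h2 : ∑ s : (Fin t → Fin (n + 1)) → G,
        (Ω.filter fun w => Φ w = s).card * Fintype.card G ^ ((n + 1) ^ t) <
        ∑ _s : (Fin t → Fin (n + 1)) → G, Ω.card :=
      Finset.sum_lt_sum_of_nonempty Finset.univ_nonempty (fun s _ => hlt s)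
    rw [← Finset.sum_mul, ← h1] at h2
    simp only [Finset.sum_const, Finset.card_univ, Fintype.card_pi, Finset.prod_const,
      Fintype.card_fin, smul_eq_mul] at h2
    rw [mul_comm] at h2
    exact lt_irrefl _ h2
  have hinj : Function.Injective
      (fun w : (Fin t → Fin n) → β → Fin t => fun z : (Fin t → Fin n) × β => w z.1 z.2) := by
    intro w w' h
    funext l i
    exact congrFun h (l, i)
  refine ⟨(Ω.filter fun w => Φ w = s).image (fun w z => w z.1 z.2), ?_, ?_⟩
  · intro y hy y' hy' hne a
    obtain ⟨w, hw, rfl⟩ := Finset.mem_image.1 hy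
    obtain ⟨w', hw', rfl⟩ := Finset.mem_image.1 hy'
    obtain ⟨p₀, hp₀⟩ := Function.ne_iff.1 (fun h : w = w' => hne (by rw [h]))
    obtain ⟨hwΩ, hwΦ⟩ := Finset.mem_filter.1 hw
    obtain ⟨hwΩ', hwΦ'⟩ := Finset.mem_filter.1 hw'
    -- At a differing block extremal in direction `a`, the rest of the window at `p + e_a` agrees,
    -- so the equal sums force equal `a`-colours at `p`.
    obtain ⟨p, hp, hmax⟩ := Finset.exists_max_image
      (Finset.univ.filter fun p => w p ≠ w' p) (fun p => p a) ⟨p₀, by simpa using hp₀⟩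
    have hpne : w p ≠ w' p := (Finset.mem_filter.1 hp).2
    have hΦ : Φ w (gridStep a p) = Φ w' (gridStep a p) := by rw [hwΦ, hwΦ']
    have hcol : c a (w p) = c a (w' p) := by
      simp only [Φ] at hΦ
      rw [Fintype.sum_eq_add_sum_compl (a, p), Fintype.sum_eq_add_sum_compl (a, p)] at hΦ
      have hrest : ∑ z ∈ ({(a, p)} : Finset (Fin t × (Fin t → Fin n)))ᶜ,
            (if gridStep z.1 z.2 = gridStep a p then c z.1 (w z.2) else 0) =
          ∑ z ∈ ({(a, p)} : Finset (Fin t × (Fin t → Fin n)))ᶜ,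
            (if gridStep z.1 z.2 = gridStep a p then c z.1 (w' z.2) else 0) := by
        refine Finset.sum_congr rfl ?_
        rintro ⟨b, p'⟩ hz
        split_ifs with heq
        · have hba : b ≠ a := by
            rintro rfl
            rw [Finset.mem_compl, Finset.mem_singleton] at hz
            exact hz (congrArg (Prod.mk b) (gridStep_injective b heq))
          have hlt := lt_of_gridStep_eq hba heq
          have : w p' = w' p' := by
            by_contra hne'
            exact absurd (hmax p' (by simpa using hne')) (not_le.2 hlt)
          simp only [this]
        · rfl
      rw [hrest] at hΦ
      simpa using add_right_cancel hΦ
    obtain ⟨i, hi⟩ := hc a (w p) (Fintype.mem_piFinset.1 hwΩ p) (w' p)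
      (Fintype.mem_piFinset.1 hwΩ' p) hpne hcol
    exact ⟨(p, i), hi⟩
  · rw [Finset.card_image_of_injective _ hinj, ← hcard]
    exact hs

/-! ### Balanced blocks and their counts -/

/-- The positions at which a string has the letter `a`. -/
def letterPositions {β : Type*} [Fintype β] {t : ℕ} (a : Fin t) (x : β → Fin t) : Finset β :=
  Finset.univ.filter fun i => x i = a

theorem exists_separating_of_letterPositions_eq {β : Type*} [Fintype β] {t : ℕ} {a : Fin t}
    {x x' : β → Fin t} (hne : x ≠ x') (h : letterPositions a x = letterPositions a x') :
    ∃ i, x i ≠ x' i ∧ x i ≠ a ∧ x' i ≠ a := by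
  obtain ⟨i, hi⟩ := Function.ne_iff.1 hne
  have hiff : x i = a ↔ x' i = a := by
    have := Finset.ext_iff.1 h i
    simpa [letterPositions] using this
  refine ⟨i, hi, fun hx => hi ?_, fun hx => hi ?_⟩
  · rw [hx, hiff.1 hx]
  · rw [hx, hiff.2 hx]

/-- The strings of length `t * m` in which every letter occurs exactly `m` times. -/
def balancedStrings (t m : ℕ) : Finset (Fin t × Fin m → Fin t) :=
  Finset.univ.filter fun x => ∀ a, (letterPositions a x).card = m

theorem card_letterPositions_shift {t m : ℕ} [NeZero t] (τ : Fin t → ℕ)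
    (w : Fin t → Fin m → Fin t) (hw : ∀ j b, (letterPositions b (w j)).card = τ b) (a : Fin t) :
    (letterPositions a (fun z : Fin t × Fin m => w z.1 z.2 + z.1)).card = m := by
  have hτ : ∑ b, τ b = m := by
    have h1 := Finset.card_eq_sum_card_fiberwise (f := w 0) (s := Finset.univ)
      (t := Finset.univ) (fun _ _ => Finset.mem_coe.2 (Finset.mem_univ _))
    rw [Finset.card_univ, Fintype.card_fin] at h1
    rw [h1]
    exact Finset.sum_congr rfl fun b _ => (hw 0 b).symm
  have h2 : (letterPositions a (fun z : Fin t × Fin m => w z.1 z.2 + z.1)).card =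
      ∑ j : Fin t, (letterPositions (a - j) (w j)).card := by
    simp only [letterPositions, Finset.card_filter, Fintype.sum_prod_type, eq_sub_iff_add_eq]
  rw [h2]
  simp only [hw]
  rw [← hτ]
  exact (Equiv.subLeft a).sum_comp τ

/-- Some vector `τ` of letter counts is shared by at least `t ^ m / (m + 1) ^ t` strings of length
`m`. Joining `t` of them, the `j`-th shifted cyclically by `j`, gives each letter `∑ τ = m`
occurrences. -/
theorem pow_le_card_balancedStrings (t m : ℕ) [NeZero t] :
    t ^ (t * m) ≤ (balancedStrings t m).card * (m + 1) ^ (t * t) := by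
  classical
  let type : (Fin m → Fin t) → Fin t → Fin (m + 1) := fun y b =>
    ⟨(letterPositions b y).card, Nat.lt_succ_of_le (by
      simpa using Finset.card_le_univ (letterPositions b y))⟩
  obtain ⟨τ, hτ⟩ : ∃ τ, t ^ m ≤
      (Finset.univ.filter fun y => type y = τ).card * (m + 1) ^ t := by
    by_contra! hlt
    have h1 : (Finset.univ : Finset (Fin m → Fin t)).card =
        ∑ τ : Fin t → Fin (m + 1), (Finset.univ.filter fun y => type y = τ).card :=
      Finset.card_eq_sum_card_fiberwise (fun _ _ => Finset.mem_coe.2 (Finset.mem_univ _))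
    have h2 := Finset.sum_lt_sum_of_nonempty
      (Finset.univ_nonempty (α := Fin t → Fin (m + 1))) (fun τ _ => hlt τ)
    rw [← Finset.sum_mul, ← h1] at h2
    simp only [Finset.sum_const, Finset.card_univ, Fintype.card_pi, Finset.prod_const,
      Fintype.card_fin, smul_eq_mul] at h2
    rw [mul_comm] at h2
    exact lt_irrefl _ h2
  set S : Finset (Fin m → Fin t) := Finset.univ.filter fun y => type y = τ with hS
  have hle : S.card ^ t ≤ (balancedStrings t m).card := by
    have hcard : (Fintype.piFinset fun _ : Fin t => S).card = S.card ^ t := by simp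
    rw [← hcard]
    refine Finset.card_le_card_of_injOn (fun w z => w z.1 z.2 + z.1) ?_ ?_
    · intro w hw
      have hw' := Fintype.mem_piFinset.1 (Finset.mem_coe.1 hw)
      refine Finset.mem_coe.2 (Finset.mem_filter.2 ⟨Finset.mem_univ _, fun a => ?_⟩)
      refine card_letterPositions_shift (fun b => (τ b : ℕ)) w (fun j b => ?_) a
      have := (Finset.mem_filter.1 (hw' j)).2
      exact congrArg Fin.val (congrFun this b)
    · intro w _ w' _ h
      funext j i
      exact add_right_cancel (congrFun h (j, i))
  calc t ^ (t * m) = (t ^ m) ^ t := by rw [mul_comm, pow_mul]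
    _ ≤ (S.card * (m + 1) ^ t) ^ t := Nat.pow_le_pow_left hτ t
    _ = S.card ^ t * (m + 1) ^ (t * t) := by rw [mul_pow, ← pow_mul]
    _ ≤ _ := Nat.mul_le_mul_right _ hle

theorem exists_injOn_zmod {α : Type*} (S : Finset α) (K : ℕ) [NeZero K] (hS : S.card = K) :
    ∃ f : α → ZMod K, Set.InjOn f S := by
  classical
  have e : S ≃ ZMod K := Fintype.equivOfCardEq (by simp [hS, ZMod.card])
  refine ⟨fun x => if h : x ∈ S then e ⟨x, h⟩ else 0, ?_⟩
  intro x hx y hy h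
  have hx' : x ∈ S := hx
  have hy' : y ∈ S := hy
  simp only [hx', hy', dif_pos] at h
  simpa using e.injective h

theorem exists_separated_grid (t m n : ℕ) [NeZero t] :
    ∃ X : Finset ((Fin t → Fin n) × (Fin t × Fin m) → Fin t), Separated X ∧
      (balancedStrings t m).card ^ (n ^ t) ≤
        X.card * ((t * m).choose m) ^ ((n + 1) ^ t) := by
  classical
  have hpos : 0 < (t * m).choose m :=
    Nat.choose_pos (Nat.le_mul_of_pos_left m (Nat.pos_of_neZero t))
  have : NeZero ((t * m).choose m) := ⟨hpos.ne'⟩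
  obtain ⟨f, hf⟩ := exists_injOn_zmod
    (Finset.powersetCard m (Finset.univ : Finset (Fin t × Fin m))) ((t * m).choose m) (by simp)
  obtain ⟨X, hX, hcard⟩ := exists_separated_of_colouring (balancedStrings t m)
    (fun a x => f (letterPositions a x)) (fun a x hx x' hx' hne heq => by
      refine exists_separating_of_letterPositions_eq hne (hf ?_ ?_ heq)
      · exact Finset.mem_coe.2 (Finset.mem_powersetCard.2
          ⟨Finset.subset_univ _, (Finset.mem_filter.1 hx).2 a⟩)
      · exact Finset.mem_coe.2 (Finset.mem_powersetCard.2
          ⟨Finset.subset_univ _, (Finset.mem_filter.1 hx').2 a⟩)) n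
  refine ⟨X, hX, ?_⟩
  simpa only [ZMod.card] using hcard

/-- A single term of the binomial expansion of `(1 + (t - 1)) ^ (t * m)`. -/
theorem choose_mul_pow_le (t m : ℕ) (ht : 1 ≤ t) :
    (t * m).choose m * (t - 1) ^ ((t - 1) * m) ≤ t ^ (t * m) := by
  have hm : m ≤ t * m := Nat.le_mul_of_pos_left m ht
  have h := add_pow 1 (t - 1) (t * m)
  have h' := Finset.single_le_sum
    (f := fun i => 1 ^ i * (t - 1) ^ (t * m - i) * (t * m).choose i)
    (fun i _ => Nat.zero_le _) (Finset.mem_range.2 (Nat.lt_succ_of_le hm))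
  rw [Nat.add_sub_cancel' ht] at h
  replace h' := h'.trans_eq h.symm
  simp only [one_pow, one_mul] at h'
  rw [Nat.sub_mul, one_mul, mul_comm]
  exact h'

/-! ### Asymptotic rate -/

theorem log_card_grid_lower {t m : ℕ} (ht : 3 ≤ t) {N : ℕ}
    (h : (balancedStrings t m).card ^ (m ^ t) ≤ N * ((t * m).choose m) ^ ((m + 1) ^ t)) :
    0 < N ∧ (m : ℝ) ^ t * (((t : ℝ) - 1) * m * Real.log (t - 1) - t * t * Real.log (m + 1)) -
      (((m : ℝ) + 1) ^ t - (m : ℝ) ^ t) * (t * m * Real.log t) ≤ Real.log N := by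
  have : NeZero t := ⟨by omega⟩
  set V := (balancedStrings t m).card with hV
  set K := (t * m).choose m with hK
  have hVle := pow_le_card_balancedStrings t m
  have hKle := choose_mul_pow_le t m (by omega)
  rw [← hV] at hVle
  rw [← hK] at hKle
  have hKpos : 0 < K := Nat.choose_pos (Nat.le_mul_of_pos_left m (by omega))
  have hVpos : 0 < V := by
    refine Nat.pos_of_ne_zero fun h0 => ?_
    rw [h0, zero_mul] at hVle
    exact absurd hVle (not_le.2 (pow_pos (by omega) _))
  have hNpos : 0 < N := by
    refine Nat.pos_of_ne_zero fun h0 => ?_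
    rw [h0, zero_mul] at h
    exact absurd h (not_le.2 (pow_pos hVpos _))
  have htR : (3 : ℝ) ≤ t := by exact_mod_cast ht
  have hKR : (0 : ℝ) < K := by exact_mod_cast hKpos
  have hVR : (0 : ℝ) < V := by exact_mod_cast hVpos
  have hNR : (0 : ℝ) < N := by exact_mod_cast hNpos
  have hmR : (0 : ℝ) < (m : ℝ) + 1 := by positivity
  have ht1 : (0 : ℝ) < (t : ℝ) - 1 := by linarith
  have ht0 : (0 : ℝ) < t := by linarith
  have e1 : (m : ℝ) ^ t * Real.log V ≤
      Real.log N + ((m : ℝ) + 1) ^ t * Real.log K := by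
    have h' : (V : ℝ) ^ (m ^ t) ≤ N * (K : ℝ) ^ ((m + 1) ^ t) := by exact_mod_cast h
    have := Real.log_le_log (by positivity) h'
    rw [Real.log_mul (by positivity) (by positivity), Real.log_pow, Real.log_pow] at this
    exact_mod_cast this
  have e2 : (t : ℝ) * m * Real.log t ≤ Real.log V + t * t * Real.log (m + 1) := by
    have h' : (t : ℝ) ^ (t * m) ≤ V * ((m : ℝ) + 1) ^ (t * t) := by exact_mod_cast hVle
    have := Real.log_le_log (by positivity) h'
    rw [Real.log_mul (by positivity) (by positivity), Real.log_pow, Real.log_pow] at this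
    exact_mod_cast this
  have e3 : Real.log K + ((t : ℝ) - 1) * m * Real.log (t - 1) ≤ t * m * Real.log t := by
    have hcast : ((t - 1 : ℕ) : ℝ) = (t : ℝ) - 1 := by
      rw [Nat.cast_sub (by omega), Nat.cast_one]
    have h' : (K : ℝ) * ((t - 1 : ℕ) : ℝ) ^ ((t - 1) * m) ≤ (t : ℝ) ^ (t * m) := by
      exact_mod_cast hKle
    rw [hcast] at h'
    have := Real.log_le_log (by positivity) h'
    rw [Real.log_mul (by positivity) (by positivity), Real.log_pow, Real.log_pow] at this
    push_cast at this
    rwa [hcast] at this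
  have e4 : Real.log K ≤ t * m * Real.log t := by
    have : 0 ≤ ((t : ℝ) - 1) * m * Real.log (t - 1) :=
      mul_nonneg (by positivity) (Real.log_nonneg (by linarith))
    linarith
  refine ⟨hNpos, ?_⟩
  have hmt : (0 : ℝ) ≤ (m : ℝ) ^ t := by positivity
  have hdiff : (0 : ℝ) ≤ ((m : ℝ) + 1) ^ t - (m : ℝ) ^ t :=
    sub_nonneg.2 (pow_le_pow_left₀ (by positivity) (by linarith) t)
  have f1 := mul_le_mul_of_nonneg_left
    (show ((t : ℝ) - 1) * m * Real.log (t - 1) - t * t * Real.log (m + 1) ≤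
      Real.log V - Real.log K by linarith) hmt
  have f2 := mul_le_mul_of_nonneg_left e4 hdiff
  linarith

/-- The loss per position when `n = m`: first from the polynomial factor in the balanced count, then
from the excess of windows over blocks. -/
theorem tendsto_rate_error (t : ℕ) :
    Filter.Tendsto (fun m : ℕ => (t : ℝ) * (Real.log (m + 1) / m) +
      ((((m : ℝ) + 1) / m) ^ t - 1) * Real.log t) Filter.atTop (nhds 0) := by
  have hinv : Filter.Tendsto (fun m : ℕ => ((m : ℝ) + 1) / m) Filter.atTop (nhds 1) := by
    have h := (tendsto_one_div_atTop_nhds_zero_nat (𝕜 := ℝ)).const_add 1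
    rw [add_zero] at h
    refine h.congr' ?_
    filter_upwards [Filter.eventually_gt_atTop 0] with m hm
    have : (m : ℝ) ≠ 0 := by positivity
    field_simp
  have hlog : Filter.Tendsto (fun m : ℕ => Real.log (m + 1) / m) Filter.atTop (nhds 0) := by
    have h1 : Filter.Tendsto (fun m : ℕ => Real.log ((m : ℝ) + 1) / ((m : ℝ) + 1))
        Filter.atTop (nhds 0) := by
      have := Real.isLittleO_log_id_atTop.tendsto_div_nhds_zero
      exact this.comp (Filter.tendsto_atTop_add_const_right _ 1 tendsto_natCast_atTop_atTop)
    have h2 := h1.mul hinv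
    rw [zero_mul] at h2
    refine h2.congr' ?_
    filter_upwards with m
    have : (m : ℝ) + 1 ≠ 0 := by positivity
    rw [div_mul_div_cancel₀ this]
  have h := (hlog.const_mul (t : ℝ)).add (((hinv.pow t).sub_const 1).mul_const (Real.log t))
  simpa using h

theorem exists_separated_log_card (t : ℕ) (ht : 3 ≤ t) (ε : ℝ) (hε : 0 < ε) :
    ∃ k : ℕ, 0 < k ∧ ∃ X : Finset (Fin k → Fin t), Separated X ∧ 0 < X.card ∧
      (((t : ℝ) - 1) / t * Real.log (t - 1) - ε) * k ≤ Real.log X.card := by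
  have : NeZero t := ⟨by omega⟩
  obtain ⟨m, hm, hm0⟩ := (((tendsto_rate_error t).eventually_lt_const hε).and
    (Filter.eventually_gt_atTop 0)).exists
  obtain ⟨X, hX, hcard⟩ := exists_separated_grid t m m
  have e : (Fin t → Fin m) × (Fin t × Fin m) ≃ Fin (m ^ t * (t * m)) :=
    Fintype.equivFinOfCardEq (by simp)
  obtain ⟨Y, hY, hYX⟩ := hX.exists_extend e e.injective
  obtain ⟨hpos, hlog⟩ := log_card_grid_lower ht hcard
  refine ⟨m ^ t * (t * m), by positivity, Y, hY, hYX ▸ hpos, ?_⟩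
  rw [hYX]
  refine le_trans ?_ hlog
  have hmR : (0 : ℝ) < m := by exact_mod_cast hm0
  have htR : (0 : ℝ) < t := by exact_mod_cast (by omega : 0 < t)
  have key := mul_le_mul_of_nonneg_right hm.le
    (show (0 : ℝ) ≤ (m : ℝ) ^ t * (t * m) by positivity)
  have heq : ((t : ℝ) * (Real.log (m + 1) / m) +
      ((((m : ℝ) + 1) / m) ^ t - 1) * Real.log t) * ((m : ℝ) ^ t * (t * m)) =
      (m : ℝ) ^ t * (t * t * Real.log (m + 1)) +
      (((m : ℝ) + 1) ^ t - (m : ℝ) ^ t) * (t * m * Real.log t) := by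
    rw [div_pow]
    field_simp
  have heq2 : ((t : ℝ) - 1) / t * Real.log (t - 1) * ((m : ℝ) ^ t * (t * m)) =
      (m : ℝ) ^ t * (((t : ℝ) - 1) * m * Real.log (t - 1)) := by
    field_simp
  push_cast
  rw [sub_mul, heq2]
  rw [heq] at key
  linarith

/-! ### All lengths and exact sizes -/

theorem eventually_exists_separated_log_card (t : ℕ) (ht : 3 ≤ t) (ε : ℝ) (hε : 0 < ε) :
    ∀ᶠ k : ℕ in Filter.atTop, ∃ X : Finset (Fin k → Fin t), Separated X ∧ 0 < X.card ∧
      (((t : ℝ) - 1) / t * Real.log (t - 1) - ε) * k ≤ Real.log X.card := by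
  have : NeZero t := ⟨by omega⟩
  obtain ⟨k₀, hk₀, X, hX, hpos, hlog⟩ := exists_separated_log_card t ht (ε / 2) (by linarith)
  -- The spare `ε / 2` absorbs the fewer than `k₀` padded positions.
  set r := ((t : ℝ) - 1) / t * Real.log (t - 1) with hr
  have hlarge : ∀ᶠ k : ℕ in Filter.atTop, |r - ε / 2| * k₀ ≤ ε / 2 * k :=
    (tendsto_natCast_atTop_atTop.const_mul_atTop (by linarith : 0 < ε / 2)).eventually_ge_atTop _
  filter_upwards [hlarge] with k hk
  obtain ⟨Y, hY, hYX⟩ := hX.exists_pow (k / k₀)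
  have hle : k / k₀ * k₀ ≤ k := Nat.div_mul_le_self k k₀
  obtain ⟨Z, hZ, hZY⟩ := hY.exists_extend (fun z => Fin.castLE hle (finProdFinEquiv z))
    ((Fin.castLE_injective hle).comp finProdFinEquiv.injective)
  have hcard : Z.card = X.card ^ (k / k₀) := hZY.trans hYX
  refine ⟨Z, hZ, hcard ▸ pow_pos hpos _, ?_⟩
  rw [hcard, Nat.cast_pow, Real.log_pow]
  have h1 := mul_le_mul_of_nonneg_left hlog (Nat.cast_nonneg (α := ℝ) (k / k₀))
  refine le_trans ?_ h1
  have hdm : ((k / k₀ : ℕ) : ℝ) * k₀ = k - (k % k₀ : ℕ) := by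
    have : k / k₀ * k₀ + k % k₀ = k := Nat.div_add_mod' k k₀
    rw [eq_sub_iff_add_eq]
    exact_mod_cast this
  have hmod : ((k % k₀ : ℕ) : ℝ) ≤ k₀ := by exact_mod_cast (Nat.mod_lt k hk₀).le
  have h2 : (r - ε / 2) * (k % k₀ : ℕ) ≤ |r - ε / 2| * k₀ :=
    mul_le_mul (le_abs_self _) hmod (Nat.cast_nonneg _) (abs_nonneg _)
  have h3 : ((k / k₀ : ℕ) : ℝ) * ((r - ε / 2) * k₀) =
      (r - ε / 2) * k - (r - ε / 2) * (k % k₀ : ℕ) := by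
    rw [mul_left_comm, hdm, mul_sub]
  rw [h3]
  linarith

/-- Separated sets of nearly the size `(t - 1) ^ ((t - 1) / t * k)`, and never above it. -/
theorem exists_separated_card_eq (t : ℕ) (ht : 3 ≤ t) :
    ∃ s : ℕ → ℕ, (∀ k, 0 < s k ∧ ∃ X : Finset (Fin k → Fin t), Separated X ∧ X.card = s k) ∧
      (∀ k, Real.log (s k) ≤ ((t : ℝ) - 1) / t * Real.log (t - 1) * k) ∧
      ∀ ε > 0, ∀ᶠ k : ℕ in Filter.atTop,
        (((t : ℝ) - 1) / t * Real.log (t - 1) - ε) * k ≤ Real.log (s k) := by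
  classical
  have : NeZero t := ⟨by omega⟩
  have htR : (3 : ℝ) ≤ t := by exact_mod_cast ht
  set r := ((t : ℝ) - 1) / t * Real.log (t - 1) with hr
  have hrpos : 0 < r :=
    mul_pos (div_pos (by linarith) (by linarith)) (Real.log_pos (by linarith))
  let P : ℕ → ℕ → Prop := fun k n => ∃ X : Finset (Fin k → Fin t), Separated X ∧ X.card = n
  have hP1 : ∀ k, P k 1 := fun k =>
    ⟨{fun _ => 0}, separated_singleton _, Finset.card_singleton _⟩
  have hfloor : ∀ k : ℕ, 1 ≤ ⌊Real.exp (r * k)⌋₊ := fun k =>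
    Nat.le_floor (by simpa using Real.one_le_exp (mul_nonneg hrpos.le (Nat.cast_nonneg k)))
  have hspos : ∀ k : ℕ, 0 < Nat.findGreatest (P k) ⌊Real.exp (r * k)⌋₊ := fun k =>
    Nat.le_findGreatest (hfloor k) (hP1 k)
  -- The cap at `exp (r * k)` keeps `δ` nonnegative for `k > 0`, so no upper bound on separated sets
  -- is needed.
  refine ⟨fun k => Nat.findGreatest (P k) ⌊Real.exp (r * k)⌋₊, fun k => ⟨hspos k, ?_⟩,
    fun k => ?_, fun ε hε => ?_⟩
  · exact Nat.findGreatest_spec (hfloor k) (hP1 k)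
  · have h1 : (Nat.findGreatest (P k) ⌊Real.exp (r * k)⌋₊ : ℝ) ≤ Real.exp (r * k) :=
      (Nat.le_floor_iff (Real.exp_pos _).le).1 (Nat.findGreatest_le _)
    rw [Real.log_le_iff_le_exp (by exact_mod_cast hspos k)]
    exact h1
  · have hbig : ∀ᶠ k : ℕ in Filter.atTop, Real.log 2 ≤ min ε r * k :=
      (tendsto_natCast_atTop_atTop.const_mul_atTop (lt_min hε hrpos)).eventually_ge_atTop _
    filter_upwards [eventually_exists_separated_log_card t ht ε hε, hbig] with k hk hk2
    obtain ⟨X, hX, hpos, hlog⟩ := hk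
    rw [Real.le_log_iff_exp_le (by exact_mod_cast hpos)] at hlog
    rw [Real.le_log_iff_exp_le (by exact_mod_cast hspos k)]
    have hk0 : (0 : ℝ) ≤ k := Nat.cast_nonneg k
    have hε2 : Real.log 2 ≤ ε * k := hk2.trans (mul_le_mul_of_nonneg_right (min_le_left _ _) hk0)
    have hr2 : Real.log 2 ≤ r * k := hk2.trans (mul_le_mul_of_nonneg_right (min_le_right _ _) hk0)
    have hceil : ⌈Real.exp ((r - ε) * k)⌉₊ ≤ X.card := Nat.ceil_le.2 hlog
    obtain ⟨Y, hYX, hY⟩ := Finset.exists_subset_card_eq hceil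
    -- Room for an integer between the two bounds, so that rounding up stays under the cap.
    have hexp : Real.exp ((r - ε) * k) + 1 ≤ Real.exp (r * k) := by
      have h1 : 2 ≤ Real.exp (ε * k) := (Real.log_le_iff_le_exp two_pos).1 hε2
      have h2 : 2 ≤ Real.exp (r * k) := (Real.log_le_iff_le_exp two_pos).1 hr2
      have h3 : Real.exp ((r - ε) * k) * Real.exp (ε * k) = Real.exp (r * k) := by
        rw [← Real.exp_add]
        ring_nf
      have h4 := mul_le_mul_of_nonneg_left h1 (Real.exp_pos ((r - ε) * k)).le
      linarith
    have hle : ⌈Real.exp ((r - ε) * k)⌉₊ ≤ ⌊Real.exp (r * k)⌋₊ :=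
      Nat.le_floor ((Nat.ceil_lt_add_one (Real.exp_pos _).le).le.trans hexp)
    have hfin : ⌈Real.exp ((r - ε) * k)⌉₊ ≤ Nat.findGreatest (P k) ⌊Real.exp (r * k)⌋₊ :=
      Nat.le_findGreatest hle ⟨Y, hX.mono hYX, hY⟩
    exact (Nat.le_ceil _).trans (by exact_mod_cast hfin)

theorem mainTheorem2 (t : ℕ) (ht : 3 ≤ t) :
    ∃ δ : ℕ → ℝ, Filter.Tendsto δ Filter.atTop (nhds 0) ∧
      ∀ k : ℕ, ∃ X : Finset (Fin k → Fin t),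
        (X.card : ℝ) = ((t : ℝ) - 1) ^ ((((t : ℝ) - 1) / (t : ℝ) - δ k) * (k : ℝ)) ∧
        ∀ x ∈ X, ∀ x' ∈ X, x ≠ x' → ∀ a : Fin t,
          ∃ i : Fin k, x i ≠ x' i ∧ x i ≠ a ∧ x' i ≠ a := by
  have htR : (3 : ℝ) ≤ t := by exact_mod_cast ht
  have ht1 : (0 : ℝ) < (t : ℝ) - 1 := by linarith
  have hl : 0 < Real.log ((t : ℝ) - 1) := Real.log_pos (by linarith)
  obtain ⟨s, hs, hupper, hlower⟩ := exists_separated_card_eq t ht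
  refine ⟨fun k => ((t : ℝ) - 1) / t - Real.log (s k) / (Real.log (t - 1) * k), ?_, fun k => ?_⟩
  · rw [Metric.tendsto_atTop']
    intro ε hε
    obtain ⟨n, hn⟩ := Filter.eventually_atTop.1
      (hlower (ε / 2 * Real.log (t - 1)) (mul_pos (by linarith) hl))
    refine ⟨n, fun k hk => ?_⟩
    have hk0 : (0 : ℝ) < k := by exact_mod_cast (by omega : 0 < k)
    have hd : 0 < Real.log ((t : ℝ) - 1) * k := mul_pos hl hk0
    have h1 := (div_le_iff₀ hd).2 ((hupper k).trans_eq (mul_assoc _ _ _))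
    have h2 : ((t : ℝ) - 1) / t - ε / 2 ≤ Real.log (s k) / (Real.log (t - 1) * k) := by
      rw [le_div_iff₀ hd]
      refine le_trans (le_of_eq ?_) (hn k hk.le)
      ring
    rw [Real.dist_eq, sub_zero, abs_lt]
    constructor <;> linarith
  · obtain ⟨hpos, X, hX, hcard⟩ := hs k
    refine ⟨X, ?_, hX⟩
    have hposR : (0 : ℝ) < s k := by exact_mod_cast hpos
    rw [hcard, sub_sub_cancel, Real.rpow_def_of_pos ht1]
    -- At length 0 the exponent vanishes whatever `δ` is; the cap forces `s 0 = 1`.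
    rcases Nat.eq_zero_or_pos k with rfl | hk
    · have h1 := hupper 0
      have h2 : (1 : ℝ) ≤ s 0 := by exact_mod_cast hpos
      rw [Nat.cast_zero, mul_zero] at h1
      have h3 := (Real.log_nonpos_iff hposR.le).1 h1
      simp only [Nat.cast_zero, mul_zero, Real.exp_zero]
      linarith
    · have hk0 : (k : ℝ) ≠ 0 := by positivity
      have : Real.log ((t : ℝ) - 1) * (Real.log (s k) / (Real.log (t - 1) * k) * k) =
          Real.log (s k) := by
        field_simp
      rw [this, Real.exp_log hposR]
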